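/- Let $d\in\mathbb N$, let $G,\alpha\colon\mathbb R^d\to\mathbb R$, and write $(x,v)\in\mathbb R^{2d}=\mathbb R^d\times\mathbb R^d$. Assume: (A1) $G\in W^{1,\infty}_{\mathrm{loc}}(\mathbb R^d)$, $G$ is bounded from below, and $\int_{\mathbb R^d}e^{-G(x)}\,\mathrm dx<\infty$; (A2) $\alpha\in W^{1,\infty}(\mathbb R^d)$; (A3) $G\in C^2(\mathbb R^d)$; either there is $\rho$ with $|\nabla^2G(x)|\le\rho(1+|\nabla G(x)|)$ for all $x$, or $\nabla^2G\in L^\infty$; and the probability measure $\nu(\mathrm dx)=Z_\nu^{-1}e^{-G(x)}\,\mathrm dx$ satisfies a Poincaré inequality, i.e. there is $r>0$ with $\|\varphi\|_{L^2(\nu)}^2\le\frac1{2r}\|\nabla\varphi\|_{L^2(\nu)}^2$ for all $\varphi\in H^1(\nu)$ with $\int\varphi\,\mathrm d\nu=0$. Let $\mu(\mathrm dx\,\mathrm dv)=Z_\mu^{-1}e^{-\frac12|v|^2-G(x)}\,\mathrm dx\,\mathrm dv$, normalized to a probability measure, let $Y=L^2(\mathbb R^{2d},\mu)$ (real-valued),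 $Y_0=\{y\in Y:\int y\,\mathrm d\mu=0\}$, $Qy=\left(\int y\,\mathrm d\mu\right)\mathbb 1$ and $Py=y-Qy$. Let $A$ be the closure in $Y$ of the operator $$\mathcal L^*\varphi=-v^\top\nabla_x\varphi+\nabla G^\top\nabla_v\varphi-v^\top\nabla_v\varphi+\Delta_v\varphi,\qquad \varphi\in C_0^\infty(\mathbb R^{2d}),$$ and $A^\dagger$ its Hilbert space adjoint in $Y$. Let $N\varphi=\nabla\alpha^\top\nabla_v\varphi-\varphi\,\nabla\alpha^\top v$ for $\varphi\in C_0^\infty(\mathbb R^{2d})$, extended by density to a bounded operator from $Y$ to the dual $[\mathcal D(A^\dagger)]'$ of $\mathcal D(A^\dagger)$ (with the graph norm), i.e. for each $z\in\mathcal D(A^\dagger)$ the functional $y\mapsto\langle Ny,z\rangle_{\mathcal D}$ is the continuous extension to $Y$ of $\varphi\mapsto\langle N\varphi,z\rangle_Y$; and let $N'\colon\mathcal D(A^\dagger)\to Y$ be its dual, $\langle y,N'z\rangle_Y=\langle Ny,z\rangle_{\mathcal D}$. Let $I=[0,\infty)$ and $u\in L^2_{\mathrm{loc}}([0,\infty))$,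 or $I=[0,T]$ with $T<\infty$ and $u\in L^2(0,T)$, and let $y_0\in Y$. A function $y\colon I\to Y$ is called a weak solution of $\frac{\mathrm d}{\mathrm dt}y=Ay+uNy$, $y(0)=y_0$, if $y\in C(I;Y)$ and, for all $z\in\mathcal D(A^\dagger)$ and $t\in I$, $$\langle y(t)-y_0,z\rangle_Y=\int_0^t\Big(\langle y(\sigma),A^\dagger z\rangle_Y+u(\sigma)\langle Ny(\sigma),z\rangle_{\mathcal D}\Big)\,\mathrm d\sigma .$$ Then $y$ is a weak solution if and only if $y=y_1+y_2$ with $y_1=Py$ and $y_2=Qy$, where $y_1\in C(I;Y_0)$ satisfies, for all $z\in\mathcal D(A^\dagger)\cap Y_0$ and $t\in I$, $$\langle y_1(t)-Py_0,z\rangle_Y=\int_0^t\Big(\langle y_1(\sigma),A^\dagger z\rangle_Y+u(\sigma)\langle y_1(\sigma)+Qy_0,N'z\rangle_Y\Big)\,\mathrm d\sigma,$$ and $y_2(t)=Qy_0$ for all $t\in I$. In particular, every weak solution satisfies $\int_{\mathbb R^{2d}}y(t)\,\mathrm d\mu=\int_{\mathbb R^{2d}}y_0\,\mathrm d\mu$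 for all $t\in I$. -/

import Mathlib

open MeasureTheory Set
open scoped ContDiff Gradient Laplacian RealInnerProductSpace

namespace KineticFP

noncomputable section

/-- Position (or velocity) space `ℝ^d`. -/
abbrev Pos (d : ℕ) : Type := EuclideanSpace ℝ (Fin d)

/-- Phase space `ℝ^{2d}`; points are pairs `(x, v)`. -/
abbrev Phase (d : ℕ) : Type := Pos d × Pos d

/-! ### Weak gradients and first-order Sobolev classes on `ℝ^d` -/

/-- `g` is the weak (distributional) gradient of `f` on `ℝ^d`. -/
def HasWeakGradient {d : ℕ} (f : Pos d → ℝ) (g : Pos d → Pos d) : Prop :=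
  LocallyIntegrable f ∧ LocallyIntegrable g ∧
    ∀ φ : Pos d → ℝ, ContDiff ℝ ∞ φ → HasCompactSupport φ →
      ∫ x, f x • ∇ φ x = -∫ x, φ x • g x

open Classical in
/-- A weak gradient of `f` (it is unique up to null sets when it exists; `0` if there is none). -/
def weakGradient {d : ℕ} (f : Pos d → ℝ) : Pos d → Pos d :=
  if h : ∃ g, HasWeakGradient f g then h.choose else 0

/-- `f ∈ W^{1,∞}(ℝ^d)`. -/
def MemW1Infty {d : ℕ} (f : Pos d → ℝ) : Prop :=
  MemLp f ⊤ volume ∧ ∃ g, HasWeakGradient f g ∧ MemLp g ⊤ volume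

/-- `f ∈ W^{1,∞}_loc(ℝ^d)`. -/
def MemW1InftyLoc {d : ℕ} (f : Pos d → ℝ) : Prop :=
  ∃ g, HasWeakGradient f g ∧ ∀ K : Set (Pos d), IsCompact K →
    MemLp f ⊤ (volume.restrict K) ∧ MemLp g ⊤ (volume.restrict K)

/-! ### The measures `ν` and `μ` -/

/-- The measure `Z⁻¹ e^{-h} dx` with `Z = ∫ e^{-h} dx` (the zero measure if `e^{-h}` is not
integrable). -/
def gibbs {X : Type*} [MeasureSpace X] (h : X → ℝ) : Measure X :=
  volume.withDensity fun x =>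
    ENNReal.ofReal ((∫ x', Real.exp (-h x'))⁻¹ * Real.exp (-h x))

instance isFiniteMeasure_gibbs {X : Type*} [MeasureSpace X] (h : X → ℝ) : IsFiniteMeasure (gibbs h) := by
  unfold gibbs
  by_cases hi : Integrable fun x => Real.exp (-h x)
  · exact isFiniteMeasure_withDensity_ofReal (hi.const_mul _).2
  · simp only [integral_undef hi, inv_zero, zero_mul, ENNReal.ofReal_zero]
    refine isFiniteMeasure_withDensity (by simp)

/-- The Hamiltonian `H(x, v) = |v|² / 2 + G(x)`. -/
def hamiltonian {d : ℕ} (G : Pos d → ℝ) (p : Phase d) : ℝ :=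
  1 / 2 * ‖p.2‖ ^ 2 + G p.1

/-- The position marginal `ν(dx) = Z_ν⁻¹ e^{-G(x)} dx`. -/
abbrev nu {d : ℕ} (G : Pos d → ℝ) : Measure (Pos d) := gibbs G

/-- The invariant measure `μ(dx dv) = Z_μ⁻¹ e^{-H(x,v)} dx dv`. -/
abbrev mu {d : ℕ} (G : Pos d → ℝ) : Measure (Phase d) := gibbs (hamiltonian G)

/-! ### Standing assumptions -/

/-- The confinement potential is in `W^{1,∞}_loc`, bounded below, and `e^{-G}` is integrable. -/
structure AssumptionA1 {d : ℕ} (G : Pos d → ℝ) : Prop where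
  regular : MemW1InftyLoc G
  bddBelow : ∃ c : ℝ, ∀ x, c ≤ G x
  integrable : Integrable fun x => Real.exp (-G x)

/-- The control potential is in `W^{1,∞}`. -/
def AssumptionA2 {d : ℕ} (α : Pos d → ℝ) : Prop := MemW1Infty α

/-- The Poincaré inequality with constant `r` on `H¹(ρ) ∩ L²₀(ρ)`. -/
def Poincare {d : ℕ} (ρ : Measure (Pos d)) (r : ℝ) : Prop :=
  ∀ (f : Pos d → ℝ) (g : Pos d → Pos d), HasWeakGradient f g → MemLp f 2 ρ → MemLp g 2 ρ →
    ∫ x, f x ∂ρ = 0 → ∫ x, f x ^ 2 ∂ρ ≤ 1 / (2 * r) * ∫ x, ‖g x‖ ^ 2 ∂ρ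

/-- `G` is `C²`, its Hessian is dominated by its gradient or bounded, and `ν` satisfies a
Poincaré inequality. -/
structure AssumptionA3 {d : ℕ} (G : Pos d → ℝ) : Prop where
  contDiff : ContDiff ℝ 2 G
  hessian : (∃ ρ : ℝ, ∀ x, ‖fderiv ℝ (∇ G) x‖ ≤ ρ * (1 + ‖∇ G x‖)) ∨
    MemLp (fun x => fderiv ℝ (∇ G) x) ⊤ volume
  poincare : ∃ r : ℝ, 0 < r ∧ Poincare (nu G) r

/-! ### Differential operators on test functions -/

/-- `C_0^∞(ℝ^{2d})`. -/
def TestFun (d : ℕ) : Submodule ℝ (Phase d → ℝ) where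
  carrier := {φ | ContDiff ℝ ∞ φ ∧ HasCompactSupport φ}
  zero_mem' := ⟨contDiff_const, HasCompactSupport.zero⟩
  add_mem' h₁ h₂ := ⟨h₁.1.add h₂.1, h₁.2.add h₂.2⟩
  smul_mem' c _ h := ⟨h.1.const_smul c, h.2.smul_left (f := fun _ => c)⟩

/-- `∇_x φ`. -/
def gradX {d : ℕ} (φ : Phase d → ℝ) (p : Phase d) : Pos d := ∇ (fun x => φ (x, p.2)) p.1

/-- `∇_v φ`. -/
def gradV {d : ℕ} (φ : Phase d → ℝ) (p : Phase d) : Pos d := ∇ (fun v => φ (p.1, v)) p.2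

/-- `Δ_v φ`. -/
def laplV {d : ℕ} (φ : Phase d → ℝ) (p : Phase d) : ℝ := (Δ fun v => φ (p.1, v)) p.2

section Linearity

variable {d : ℕ} {φ ψ : Phase d → ℝ}

theorem two_le_infty : (2 : WithTop ℕ∞) ≤ ∞ :=
  WithTop.coe_le_coe.2 le_top

theorem contDiff_sliceX (h : φ ∈ TestFun d) (v : Pos d) : ContDiff ℝ ∞ fun x => φ (x, v) :=
  h.1.comp (by fun_prop)

theorem contDiff_sliceV (h : φ ∈ TestFun d) (x : Pos d) : ContDiff ℝ ∞ fun v => φ (x, v) :=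
  h.1.comp (by fun_prop)

theorem gradX_add (h₁ : φ ∈ TestFun d) (h₂ : ψ ∈ TestFun d) (p : Phase d) :
    gradX (φ + ψ) p = gradX φ p + gradX ψ p := by
  have e₁ := ((contDiff_sliceX h₁ p.2).differentiable (by simp)) p.1
  have e₂ := ((contDiff_sliceX h₂ p.2).differentiable (by simp)) p.1
  simp only [gradX, gradient, Pi.add_apply, fderiv_fun_add e₁ e₂, map_add]

theorem gradV_add (h₁ : φ ∈ TestFun d) (h₂ : ψ ∈ TestFun d) (p : Phase d) :
    gradV (φ + ψ) p = gradV φ p + gradV ψ p := by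
  have e₁ := ((contDiff_sliceV h₁ p.1).differentiable (by simp)) p.2
  have e₂ := ((contDiff_sliceV h₂ p.1).differentiable (by simp)) p.2
  simp only [gradV, gradient, Pi.add_apply, fderiv_fun_add e₁ e₂, map_add]

theorem laplV_add (h₁ : φ ∈ TestFun d) (h₂ : ψ ∈ TestFun d) (p : Phase d) :
    laplV (φ + ψ) p = laplV φ p + laplV ψ p :=
  ((contDiff_sliceV h₁ p.1).of_le two_le_infty).contDiffAt.laplacian_add
    ((contDiff_sliceV h₂ p.1).of_le two_le_infty).contDiffAt

theorem gradX_smul (c : ℝ) (h : φ ∈ TestFun d) (p : Phase d) :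
    gradX (c • φ) p = c • gradX φ p := by
  have e := ((contDiff_sliceX h p.2).differentiable (by simp)) p.1
  simp only [gradX, gradient, Pi.smul_apply, fderiv_fun_const_smul e, map_smul]

theorem gradV_smul (c : ℝ) (h : φ ∈ TestFun d) (p : Phase d) :
    gradV (c • φ) p = c • gradV φ p := by
  have e := ((contDiff_sliceV h p.1).differentiable (by simp)) p.2
  simp only [gradV, gradient, Pi.smul_apply, fderiv_fun_const_smul e, map_smul]

theorem laplV_smul (c : ℝ) (h : φ ∈ TestFun d) (p : Phase d) :
    laplV (c • φ) p = c * laplV φ p :=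
  InnerProductSpace.laplacian_smul c
    ((contDiff_sliceV h p.1).of_le two_le_infty).contDiffAt

end Linearity

/-- `𝓛* φ = -vᵀ∇_x φ + (∇G)ᵀ∇_v φ - vᵀ∇_v φ + Δ_v φ` on `C_0^∞(ℝ^{2d})`. -/
def formalLStar {d : ℕ} (G : Pos d → ℝ) : TestFun d →ₗ[ℝ] (Phase d → ℝ) where
  toFun φ p := -⟪p.2, gradX φ p⟫ + ⟪∇ G p.1, gradV φ p⟫ - ⟪p.2, gradV φ p⟫ + laplV φ p
  map_add' φ ψ := by
    ext p
    simp only [Submodule.coe_add, Pi.add_apply, gradX_add φ.2 ψ.2, gradV_add φ.2 ψ.2,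
      laplV_add φ.2 ψ.2, inner_add_right]
    ring
  map_smul' c φ := by
    ext p
    simp only [Submodule.coe_smul, Pi.smul_apply, gradX_smul c φ.2, gradV_smul c φ.2,
      laplV_smul c φ.2, inner_smul_right, RingHom.id_apply, smul_eq_mul]
    ring

/-- `N φ = (∇α)ᵀ∇_v φ - φ (∇α)ᵀ v` on `C_0^∞(ℝ^{2d})`, with `∇α` the weak gradient. -/
def formalN {d : ℕ} (α : Pos d → ℝ) : TestFun d →ₗ[ℝ] (Phase d → ℝ) where
  toFun φ p := ⟪weakGradient α p.1, gradV φ p⟫ - φ.1 p * ⟪weakGradient α p.1, p.2⟫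
  map_add' φ ψ := by
    ext p
    simp only [Submodule.coe_add, Pi.add_apply, gradV_add φ.2 ψ.2, inner_add_right]
    ring
  map_smul' c φ := by
    ext p
    simp only [Submodule.coe_smul, Pi.smul_apply, gradV_smul c φ.2, inner_smul_right,
      RingHom.id_apply, smul_eq_mul]
    ring

/-! ### The state space and the operators on it -/

/-- The state space `Y = L²_μ(ℝ^{2d})` of real-valued functions. -/
abbrev State {d : ℕ} (G : Pos d → ℝ) : Type := Lp ℝ 2 (mu G)

/-- The (class of the) constant function `𝟙 ∈ Y`. -/
def one {d : ℕ} (G : Pos d → ℝ) : State G := Lp.const 2 (mu G) (1 : ℝ)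

/-- The graph in `Y × Y` of an operator given on test functions: the pairs of classes
`([φ], [T φ])` for `φ ∈ C_0^∞` with `T φ` square integrable. -/
def testGraph {d : ℕ} (G : Pos d → ℝ) (T : TestFun d →ₗ[ℝ] (Phase d → ℝ)) :
    Submodule ℝ (State G × State G) where
  carrier := {q | ∃ φ : TestFun d, q.1 =ᵐ[mu G] φ.1 ∧ q.2 =ᵐ[mu G] T φ}
  zero_mem' := ⟨0, Lp.coeFn_zero _ _ _, by rw [map_zero]; exact Lp.coeFn_zero _ _ _⟩
  add_mem' := by
    rintro q r ⟨φ, h₁, h₂⟩ ⟨ψ, h₃, h₄⟩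
    exact ⟨φ + ψ, (Lp.coeFn_add q.1 r.1).trans (h₁.add h₃),
      by rw [map_add]; exact (Lp.coeFn_add q.2 r.2).trans (h₂.add h₄)⟩
  smul_mem' := by
    rintro c q ⟨φ, h₁, h₂⟩
    exact ⟨c • φ, (Lp.coeFn_smul c q.1).trans (h₁.const_smul c),
      by rw [map_smul]; exact (Lp.coeFn_smul c q.2).trans (h₂.const_smul c)⟩

/-- An operator given on test functions, as a densely defined operator in `Y`. -/
def testOperator {d : ℕ} (G : Pos d → ℝ) (T : TestFun d →ₗ[ℝ] (Phase d → ℝ)) :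
    State G →ₗ.[ℝ] State G :=
  (testGraph G T).toLinearPMap

/-- `A = closure of 𝓛*` in `Y`. -/
def opA {d : ℕ} (G : Pos d → ℝ) : State G →ₗ.[ℝ] State G :=
  (testOperator G (formalLStar G)).closure

/-- The Hilbert space adjoint `A†` of `A` in `Y`. -/
def opAdag {d : ℕ} (G : Pos d → ℝ) : State G →ₗ.[ℝ] State G := (opA G).adjoint

/-- `N` on `C_0^∞(ℝ^{2d}) ⊂ Y`, with values in `Y`. -/
def opN₀ {d : ℕ} (G α : Pos d → ℝ) : State G →ₗ.[ℝ] State G := testOperator G (formalN α)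

open Classical in
/-- The duality pairing `⟨N y, z⟩`: for fixed `z`, the continuous extension to all `y ∈ Y` of
`φ ↦ ⟨z, N φ⟩_Y`, `φ ∈ C_0^∞(ℝ^{2d})`. This functional is bounded on `C_0^∞` in the norm of `Y` for
every `z ∈ H¹_{μ,v}(ℝ^{2d})`, in particular for every `z ∈ D(A†)`. -/
def pairN {d : ℕ} (G α : Pos d → ℝ) (y z : State G) : ℝ :=
  if h : z ∈ (opN₀ G α).adjointDomain then (opN₀ G α).adjointDomainMkCLMExtend ⟨z, h⟩ y else 0

open Classical in
/-- The dual `N'` of `N`: it maps `z` to the element of `Y` representing `y ↦ ⟨N y, z⟩`. -/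
def dualN {d : ℕ} (G α : Pos d → ℝ) (z : State G) : State G :=
  if h : z ∈ (opN₀ G α).adjoint.domain then (opN₀ G α).adjoint ⟨z, h⟩ else 0

/-- `Y₀ = L²₀(μ)`, the functions in `Y` with mean zero. -/
def StateZero {d : ℕ} (G : Pos d → ℝ) : Set (State G) := {y | ∫ p, y p ∂(mu G) = 0}

/-- `Q y = (∫ y dμ) 𝟙`. -/
def projQ {d : ℕ} (G : Pos d → ℝ) (y : State G) : State G := (∫ p, y p ∂(mu G)) • one G

/-- `P y = y - (∫ y dμ) 𝟙`. -/
def projP {d : ℕ} (G : Pos d → ℝ) (y : State G) : State G := y - (∫ p, y p ∂(mu G)) • one G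

/-! ### Solution concepts -/

/-- The time interval `[0, T]` if `T < ∞`, and `[0, ∞)` if `T = ∞`. -/
def timeInterval (T : ENNReal) : Set ℝ := {t | 0 ≤ t ∧ ENNReal.ofReal t ≤ T}

/-- `u ∈ L²(0, T)` if `T < ∞`, and `u ∈ L²_loc([0, ∞))` if `T = ∞`. -/
def IsControl (T : ENNReal) (u : ℝ → ℝ) : Prop :=
  ∀ t ∈ timeInterval T, MemLp u 2 (volume.restrict (Ioc 0 t))

/-- `y ∈ C([0, T]; Y)` is a weak solution of `y' = A y + u N y`, `y(0) = y₀`. -/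
def IsWeakSolution {d : ℕ} (G α : Pos d → ℝ) (T : ENNReal) (u : ℝ → ℝ) (y₀ : State G)
    (y : ℝ → State G) : Prop :=
  ContinuousOn y (timeInterval T) ∧
    ∀ z : (opAdag G).domain, ∀ t ∈ timeInterval T,
      ⟪y t - y₀, (z : State G)⟫ =
        ∫ σ in (0 : ℝ)..t, (⟪y σ, opAdag G z⟫ + u σ * pairN G α (y σ) z)

/-- `y₁ ∈ C([0, T]; Y₀)` is a weak solution of the reduced equation
`y₁' = A y₁ + u N (y₁ + Q y₀)`, `y₁(0) = P y₀`, tested with `z ∈ D(A†) ∩ Y₀`. -/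
def IsReducedSolution {d : ℕ} (G α : Pos d → ℝ) (T : ENNReal) (u : ℝ → ℝ) (y₀ : State G)
    (y₁ : ℝ → State G) : Prop :=
  ContinuousOn y₁ (timeInterval T) ∧ (∀ t ∈ timeInterval T, y₁ t ∈ StateZero G) ∧
    ∀ z : (opAdag G).domain, (z : State G) ∈ StateZero G → ∀ t ∈ timeInterval T,
      ⟪y₁ t - projP G y₀, (z : State G)⟫ =
        ∫ σ in (0 : ℝ)..t,
          (⟪y₁ σ, opAdag G z⟫ + u σ * ⟪y₁ σ + projQ G y₀, dualN G α z⟫)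

end

end KineticFP

/-! The theorem says that the constant function 𝟙 decouples from the dynamics. Two facts give this,
one for each side of the duality.

First, `e^{-H} 𝓛*φ` and `e^{-H} Nφ` are divergences of compactly supported fields, so `𝓛*φ` and `Nφ`
have mean zero under `μ` (`integral_formalLStar`, `integral_formalN`). For `N` the field is `φ
e^{-H} ∇α`, differentiated in `v` only, so `∇α` need only be bounded and measurable. Hence 𝟙 lies in
the domains of `A†` and `N'` and both annihilate it; testing with `z = 𝟙` gives conservation of
mass, that is, `Qy = Qy₀`.

Second, `A†z` has mean zero for every `z ∈ D(A†)` (`integral_opAdag`). Formally this is `A𝟙 = 0`,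
but 𝟙 is not a test function, so it is approximated by cutoffs `χ`. The term `∇G · ∇_v χ` is
dangerous because `∇G` may be unbounded. It is tamed by choosing the velocity scale after the
position scale, which yields `|𝓛*χ| ≤ Cε(1 + |v|)`, and `1 + |v|` is square integrable under `μ`.

Consequently `⟨y, A†z⟩ = ⟨Py, A†z⟩`, and for mean-zero `z` the weak and reduced identities agree
term by term (`weak_iff_reduced_of_projQ_eq`). A general `z` differs from a mean-zero one by a
multiple of 𝟙, which contributes nothing. -/

namespace KineticFP

noncomputable section

/-! ### Gibbs measures with continuous potential -/

section Gibbs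

variable {X : Type*} [MeasureSpace X] {h : X → ℝ}

theorem gibbs_absolutelyContinuous (h : X → ℝ) : gibbs h ≪ volume :=
  withDensity_absolutelyContinuous _ _

variable [TopologicalSpace X] [BorelSpace X]

/-- No integrability of `e^{-h}` is needed: without it the normalizing integral is `0` by
convention, its inverse is `0`, and both sides vanish. -/
theorem integral_gibbs (hc : Continuous h) (f : X → ℝ) :
    ∫ x, f x ∂(gibbs h) = (∫ x, Real.exp (-h x))⁻¹ * ∫ x, f x * Real.exp (-h x) := by
  have hpos : 0 ≤ (∫ x, Real.exp (-h x))⁻¹ :=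
    inv_nonneg.2 (integral_nonneg fun x => (Real.exp_pos _).le)
  have hm : Measurable fun x => ENNReal.ofReal ((∫ x', Real.exp (-h x'))⁻¹ * Real.exp (-h x)) :=
    (measurable_const.mul (Real.continuous_exp.comp hc.neg).measurable).ennreal_ofReal
  rw [gibbs, integral_withDensity_eq_integral_toReal_smul hm (by simp), ← integral_const_mul]
  refine integral_congr_ae (Filter.Eventually.of_forall fun x => ?_)
  simp only [smul_eq_mul]
  rw [ENNReal.toReal_ofReal (mul_nonneg hpos (Real.exp_pos _).le)]
  ring

variable [NeZero (volume : Measure X)]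

theorem isProbabilityMeasure_gibbs (hc : Continuous h)
    (hi : Integrable fun x => Real.exp (-h x)) : IsProbabilityMeasure (gibbs h) := by
  have h1 := integral_gibbs hc fun _ => (1 : ℝ)
  rw [integral_const, smul_eq_mul, mul_one] at h1
  simp only [one_mul] at h1
  rw [inv_mul_cancel₀ (integral_exp_pos hi).ne'] at h1
  refine ⟨?_⟩
  rw [measureReal_def] at h1
  exact (ENNReal.toReal_eq_one_iff _).1 h1

theorem volume_absolutelyContinuous_gibbs (hc : Continuous h)
    (hi : Integrable fun x => Real.exp (-h x)) : volume ≪ gibbs h := by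
  have hm : Measurable fun x => ENNReal.ofReal ((∫ x', Real.exp (-h x'))⁻¹ * Real.exp (-h x)) :=
    (measurable_const.mul (Real.continuous_exp.comp hc.neg).measurable).ennreal_ofReal
  refine withDensity_absolutelyContinuous' hm.aemeasurable
    (Filter.Eventually.of_forall fun x => ?_)
  have := integral_exp_pos hi
  simp only [ne_eq, ENNReal.ofReal_eq_zero, not_le]
  positivity

end Gibbs

/-! ### The phase space measure -/

section PhaseMeasure

variable {d : ℕ} {G : Pos d → ℝ}

theorem continuous_hamiltonian (hG : Continuous G) : Continuous (hamiltonian G) := by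
  unfold hamiltonian
  fun_prop

theorem integrable_exp_neg_mul_norm_sq {b : ℝ} (hb : 0 < b) :
    Integrable fun v : Pos d => Real.exp (-b * ‖v‖ ^ 2) := by
  have h := (GaussianFourier.integrable_cexp_neg_mul_sq_norm_add (V := Pos d) (b := (b : ℂ))
    (by simpa using hb) 0 0).norm
  refine h.congr (Filter.Eventually.of_forall fun v => ?_)
  simp only [Complex.norm_exp, inner_zero_left]
  norm_cast
  simp

theorem integrable_norm_sq_mul_exp_neg :
    Integrable fun v : Pos d => ‖v‖ ^ 2 * Real.exp (-(1 / 2 * ‖v‖ ^ 2)) := by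
  -- With `s = ‖v‖² / 4`, the bound `s ≤ e^s` gives `4 s e^{-2s} ≤ 4 e^{-s}`; this is where `1 / 4`
  -- and the factor `4` come from.
  have h := (integrable_exp_neg_mul_norm_sq (d := d) (b := 1 / 4) (by norm_num)).const_mul 4
  refine h.mono' (by fun_prop) (Filter.Eventually.of_forall fun v => ?_)
  rw [Real.norm_of_nonneg (by positivity)]
  have h1 : 1 / 4 * ‖v‖ ^ 2 ≤ Real.exp (1 / 4 * ‖v‖ ^ 2) := by
    linarith [Real.add_one_le_exp (1 / 4 * ‖v‖ ^ 2)]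
  have h2 : Real.exp (-(1 / 4) * ‖v‖ ^ 2)
      = Real.exp (1 / 4 * ‖v‖ ^ 2) * Real.exp (-(1 / 2 * ‖v‖ ^ 2)) := by
    rw [← Real.exp_add]; congr 1; ring
  rw [h2]
  nlinarith [Real.exp_pos (-(1 / 2 * ‖v‖ ^ 2))]

theorem integrable_exp_neg_hamiltonian (hi : Integrable fun x => Real.exp (-G x)) :
    Integrable fun p => Real.exp (-hamiltonian G p) := by
  have h := hi.mul_prod (integrable_exp_neg_mul_norm_sq (d := d) (b := 1 / 2) (by norm_num))
  refine h.congr (Filter.Eventually.of_forall fun p => ?_)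
  simp only [hamiltonian, ← Real.exp_add]
  congr 1; ring

theorem integrable_norm_sq_mu (hG : Continuous G) (hi : Integrable fun x => Real.exp (-G x)) :
    Integrable (fun p : Phase d => ‖p.2‖ ^ 2) (mu G) := by
  have hm : Measurable fun p => ENNReal.ofReal
      ((∫ p', Real.exp (-hamiltonian G p'))⁻¹ * Real.exp (-hamiltonian G p)) :=
    (measurable_const.mul
      (Real.continuous_exp.comp (continuous_hamiltonian hG).neg).measurable).ennreal_ofReal
  rw [mu, gibbs, integrable_withDensity_iff hm (by simp)]
  have h := (hi.mul_prod (integrable_norm_sq_mul_exp_neg (d := d))).const_mul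
    (∫ p', Real.exp (-hamiltonian G p'))⁻¹
  refine h.congr (Filter.Eventually.of_forall fun p => ?_)
  have hpos : 0 ≤ (∫ p, Real.exp (-hamiltonian G p))⁻¹ :=
    inv_nonneg.2 (integral_nonneg fun x => (Real.exp_pos _).le)
  simp only
  rw [ENNReal.toReal_ofReal (mul_nonneg hpos (Real.exp_pos _).le)]
  have : Real.exp (-hamiltonian G p)
      = Real.exp (-G p.1) * Real.exp (-(1 / 2 * ‖p.2‖ ^ 2)) := by
    rw [← Real.exp_add, hamiltonian]; congr 1; ring
  rw [this]; ring

theorem memLp_norm_snd (hG : Continuous G) (hi : Integrable fun x => Real.exp (-G x)) :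
    MemLp (fun p : Phase d => ‖p.2‖) 2 (mu G) :=
  (memLp_two_iff_integrable_sq (by fun_prop)).2 (integrable_norm_sq_mu hG hi)

end PhaseMeasure


/-! ### Operators given on test functions -/

section TestOperator

variable {d : ℕ} {G : Pos d → ℝ} {T : TestFun d →ₗ[ℝ] (Phase d → ℝ)}

theorem memLp_testFun (φ : TestFun d) : MemLp φ.1 2 (mu G) :=
  φ.2.1.continuous.memLp_of_hasCompactSupport φ.2.2

theorem inner_toLp_left {f : Phase d → ℝ} (hf : MemLp f 2 (mu G)) (w : State G) :
    ⟪hf.toLp f, w⟫ = ∫ p, f p * w p ∂(mu G) := by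
  rw [L2.inner_def]
  refine integral_congr_ae ?_
  filter_upwards [hf.coeFn_toLp] with p hp
  simp [hp, mul_comm]

theorem inner_one_left (w : State G) : ⟪one G, w⟫ = ∫ p, w p ∂(mu G) := by
  rw [L2.inner_def]
  refine integral_congr_ae ?_
  filter_upwards [Lp.coeFn_const (p := 2) (μ := mu G) (1 : ℝ)] with p hp
  rw [one, hp]
  simp

/-- The density of `μ` is positive, so a test function vanishing `μ`-a.e. vanishes Lebesgue-a.e.,
hence everywhere by continuity. Its class in `Y` therefore determines it, and the operator is
single-valued. -/
theorem testGraph_functional (hG : Continuous G) (hi : Integrable fun x => Real.exp (-G x))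
    (q : State G × State G) (hq : q ∈ testGraph G T) (h0 : q.1 = 0) : q.2 = 0 := by
  obtain ⟨φ, h₁, h₂⟩ := hq
  have hae : φ.1 =ᵐ[volume] 0 := by
    refine (volume_absolutelyContinuous_gibbs (continuous_hamiltonian hG)
      (integrable_exp_neg_hamiltonian hi)).ae_le ?_
    rw [h0] at h₁
    exact h₁.symm.trans (Lp.coeFn_zero _ _ _)
  have hφ : φ = 0 :=
    Subtype.ext ((φ.2.1.continuous.ae_eq_iff_eq volume continuous_const).1 hae)
  rw [hφ, map_zero] at h₂
  exact (Lp.eq_zero_iff_ae_eq_zero).2 h₂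

theorem testOperator_graph (hG : Continuous G) (hi : Integrable fun x => Real.exp (-G x)) :
    (testOperator G T).graph = testGraph G T :=
  Submodule.toLinearPMap_graph_eq _ (testGraph_functional hG hi)

theorem toLp_mem_testGraph (hT : ∀ φ, MemLp (T φ) 2 (mu G)) (φ : TestFun d) :
    ((memLp_testFun φ).toLp φ.1, (hT φ).toLp (T φ)) ∈ testGraph G T :=
  ⟨φ, (memLp_testFun φ).coeFn_toLp, (hT φ).coeFn_toLp⟩

theorem toLp_mem_testOperator_domain (hT : ∀ φ, MemLp (T φ) 2 (mu G)) (φ : TestFun d) :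
    (memLp_testFun φ).toLp φ.1 ∈ (testOperator G T).domain :=
  ⟨_, toLp_mem_testGraph hT φ, rfl⟩

theorem testOperator_toLp (hG : Continuous G) (hi : Integrable fun x => Real.exp (-G x))
    (hT : ∀ φ, MemLp (T φ) 2 (mu G)) (φ : TestFun d) :
    testOperator G T ⟨_, toLp_mem_testOperator_domain hT φ⟩ = (hT φ).toLp (T φ) := by
  have h := toLp_mem_testGraph hT φ
  rw [← testOperator_graph hG hi, LinearPMap.mem_graph_iff] at h
  obtain ⟨y, hy₁, hy₂⟩ := h
  refine Eq.trans ?_ hy₂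
  congr 1
  exact Subtype.ext hy₁.symm

/-- Test functions are dense in `Y`. -/
theorem dense_testOperator_domain (hT : ∀ φ, MemLp (T φ) 2 (mu G)) :
    Dense ((testOperator G T).domain : Set (State G)) := by
  rw [Submodule.dense_iff_topologicalClosure_eq_top, Submodule.topologicalClosure_eq_top_iff,
    Submodule.eq_bot_iff]
  intro w hw
  rw [Submodule.mem_orthogonal] at hw
  refine (Lp.eq_zero_iff_ae_eq_zero).2 ?_
  -- The fundamental lemma of the calculus of variations, applied directly to `μ`; `w` is integrable
  -- because `μ` is finite.
  refine ae_eq_zero_of_integral_contDiff_smul_eq_zero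
    ((Lp.memLp w).integrable (by norm_num)).locallyIntegrable fun g hg hgc => ?_
  have h := hw _ (toLp_mem_testOperator_domain hT ⟨g, hg, hgc⟩)
  rw [inner_toLp_left] at h
  simpa using h

/-- If `T` maps test functions to functions with mean zero, so does the associated operator. -/
theorem inner_one_testOperator (hG : Continuous G) (hi : Integrable fun x => Real.exp (-G x))
    (h0 : ∀ φ, ∫ p, T φ p ∂(mu G) = 0) (x : (testOperator G T).domain) :
    ⟪one G, testOperator G T x⟫ = 0 := by
  have hx : ((x : State G), testOperator G T x) ∈ testGraph G T := by
    rw [← testOperator_graph hG hi]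
    exact (testOperator G T).mem_graph x
  obtain ⟨φ, -, h₂⟩ := hx
  rw [inner_one_left, ← h0 φ]
  exact integral_congr_ae h₂

end TestOperator


/-! ### Integration by parts against `μ` -/

section IntegrationByParts

variable {d : ℕ} {G : Pos d → ℝ}

/-- Integration by parts against the constant `1`. Only differentiability along `w` is asked for,
which leaves room for functions that are rough in the other directions. -/
theorem integral_hasLineDerivAt_eq_zero {E : Type*} [NormedAddCommGroup E] [NormedSpace ℝ E]
    [FiniteDimensional ℝ E] [MeasurableSpace E] [BorelSpace E] {μ : Measure E}
    [μ.IsAddHaarMeasure] {F F' : E → ℝ} {w : E} (hF : Integrable F μ) (hF' : Integrable F' μ)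
    (h : ∀ x, HasLineDerivAt ℝ F (F' x) x w) : ∫ x, F' x ∂μ = 0 := by
  have := integral_bilinear_hasLineDerivAt_right_eq_neg_left_of_integrable (μ := μ) (v := w)
    (f := fun _ : E => (1 : ℝ)) (f' := fun _ => 0) (g := F) (g' := F')
    (B := ContinuousLinearMap.mul ℝ ℝ) (by simp) (by simpa using hF') (by simpa using hF)
    (fun x _ => (hasFDerivAt_const (1 : ℝ) x).hasLineDerivAt w) (fun x _ => h x)
  simpa using this

theorem hasFDerivAt_exp_neg_hamiltonian (hG : Differentiable ℝ G) (p : Phase d) :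
    HasFDerivAt (fun q => Real.exp (-hamiltonian G q))
      (-Real.exp (-hamiltonian G p) •
        ((innerSL ℝ p.2).comp (ContinuousLinearMap.snd ℝ (Pos d) (Pos d)) +
          (fderiv ℝ G p.1).comp (ContinuousLinearMap.fst ℝ (Pos d) (Pos d)))) p := by
  have h1 : HasFDerivAt (fun q : Phase d => G q.1)
      ((fderiv ℝ G p.1).comp (ContinuousLinearMap.fst ℝ (Pos d) (Pos d))) p :=
    (hG p.1).hasFDerivAt.comp p hasFDerivAt_fst
  have h2 : HasFDerivAt (fun q : Phase d => 1 / 2 * ‖q.2‖ ^ 2)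
      ((innerSL ℝ p.2).comp (ContinuousLinearMap.snd ℝ (Pos d) (Pos d))) p := by
    refine (((hasFDerivAt_snd (𝕜 := ℝ) (p := p)).norm_sq).const_mul (1 / 2 : ℝ)).congr_fderiv ?_
    ext <;> simp
  refine (h2.add h1).neg.exp.congr_fderiv ?_
  ext <;> simp [hamiltonian]

end IntegrationByParts


/-! ### The operators `𝓛*` and `N` have mean zero on test functions -/

section MeanZero

variable {d : ℕ} {G α : Pos d → ℝ} {φ : Phase d → ℝ}

theorem inner_gradX (hφ : Differentiable ℝ φ) (a : Pos d) (p : Phase d) :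
    ⟪a, gradX φ p⟫ = fderiv ℝ φ p (a, 0) := by
  have h : HasFDerivAt (fun x => φ (x, p.2))
      ((fderiv ℝ φ p).comp (ContinuousLinearMap.inl ℝ (Pos d) (Pos d))) p.1 :=
    (hφ (p.1, p.2)).hasFDerivAt.comp p.1 (hasFDerivAt_prodMk_left p.1 p.2)
  rw [gradX, inner_gradient_right, h.fderiv]
  simp

theorem inner_gradV (hφ : Differentiable ℝ φ) (a : Pos d) (p : Phase d) :
    ⟪a, gradV φ p⟫ = fderiv ℝ φ p (0, a) := by
  have h : HasFDerivAt (fun v => φ (p.1, v))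
      ((fderiv ℝ φ p).comp (ContinuousLinearMap.inr ℝ (Pos d) (Pos d))) p.2 :=
    (hφ (p.1, p.2)).hasFDerivAt.comp p.2 (hasFDerivAt_prodMk_right p.1 p.2)
  rw [gradV, inner_gradient_right, h.fderiv]
  simp

theorem laplV_eq_sum (hφ : ContDiff ℝ 2 φ) (p : Phase d) :
    laplV φ p = ∑ i, fderiv ℝ (fun q => fderiv ℝ φ q (0, EuclideanSpace.basisFun (Fin d) ℝ i)) p
      (0, EuclideanSpace.basisFun (Fin d) ℝ i) := by
  have hd : Differentiable ℝ φ := hφ.differentiable (by simp)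
  have hd' : Differentiable ℝ (fderiv ℝ φ) :=
    (hφ.fderiv_right (m := 1) (by norm_num)).differentiable (by simp)
  have h1 : fderiv ℝ (fun v => φ (p.1, v)) = fun v =>
      (fderiv ℝ φ (p.1, v)).comp (ContinuousLinearMap.inr ℝ (Pos d) (Pos d)) := by
    funext v
    exact ((hd (p.1, v)).hasFDerivAt.comp v (hasFDerivAt_prodMk_right p.1 v)).fderiv
  rw [laplV, InnerProductSpace.laplacian_eq_iteratedFDeriv_orthonormalBasis _
    (EuclideanSpace.basisFun (Fin d) ℝ)]
  refine Finset.sum_congr rfl fun i _ => ?_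
  set e := EuclideanSpace.basisFun (Fin d) ℝ i
  have h2 : HasFDerivAt (fun v => (fderiv ℝ φ (p.1, v)).comp
      (ContinuousLinearMap.inr ℝ (Pos d) (Pos d))) _ p.2 :=
    HasFDerivAt.clm_comp ((hd' (p.1, p.2)).hasFDerivAt.comp p.2 (hasFDerivAt_prodMk_right p.1 p.2))
      (hasFDerivAt_const (ContinuousLinearMap.inr ℝ (Pos d) (Pos d)) p.2)
  have h3 : HasFDerivAt (fun q => fderiv ℝ φ q (0, e)) _ p :=
    (hd' p).hasFDerivAt.clm_apply (hasFDerivAt_const ((0, e) : Phase d) p)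
  rw [iteratedFDeriv_two_apply, h1, h2.fderiv, h3.fderiv]
  simp

theorem continuous_fderiv_testFun (φ : TestFun d) : Continuous (fderiv ℝ φ.1) :=
  φ.2.1.continuous_fderiv (by simp)

theorem differentiable_testFun (φ : TestFun d) : Differentiable ℝ φ.1 :=
  φ.2.1.differentiable (by simp)

theorem contDiff_fderiv_apply (φ : TestFun d) (w : Phase d) :
    ContDiff ℝ ∞ fun q => fderiv ℝ φ.1 q w :=
  (φ.2.1.fderiv_right (m := ∞) (by simp)).clm_apply contDiff_const

theorem hasCompactSupport_fderiv_apply {E : Type*} [NormedAddCommGroup E] [NormedSpace ℝ E]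
    {f : E → ℝ} (hf : HasCompactSupport f) (w : E → E) :
    HasCompactSupport fun x => fderiv ℝ f x (w x) :=
  (hf.fderiv ℝ).mono' fun x hx => subset_tsupport _ fun h0 => hx (by simp [h0])

theorem continuous_gradient (hG : ContDiff ℝ 1 G) : Continuous (∇ G) := by
  unfold gradient
  have := hG.continuous_fderiv (by simp)
  fun_prop

theorem formalLStar_apply (φ : TestFun d) (p : Phase d) :
    formalLStar G φ p = -fderiv ℝ φ.1 p (p.2, 0) + fderiv ℝ φ.1 p (0, ∇ G p.1)
      - fderiv ℝ φ.1 p (0, p.2)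
      + ∑ i, fderiv ℝ (fun q => fderiv ℝ φ.1 q (0, EuclideanSpace.basisFun (Fin d) ℝ i)) p
        (0, EuclideanSpace.basisFun (Fin d) ℝ i) := by
  have hd := differentiable_testFun φ
  rw [← laplV_eq_sum (φ.2.1.of_le two_le_infty), ← inner_gradX hd, ← inner_gradV hd,
    ← inner_gradV hd]
  rfl

theorem memLp_formalLStar (hG : ContDiff ℝ 1 G) (φ : TestFun d) :
    MemLp (formalLStar G φ) 2 (mu G) := by
  have hc := continuous_fderiv_testFun φ
  have hgrad := continuous_gradient hG
  have hc2 : ∀ i, Continuous fun p => fderiv ℝ (fun q => fderiv ℝ φ.1 q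
      (0, EuclideanSpace.basisFun (Fin d) ℝ i)) p (0, EuclideanSpace.basisFun (Fin d) ℝ i) :=
    fun i => ((contDiff_fderiv_apply φ _).continuous_fderiv (by simp)).clm_apply continuous_const
  rw [show formalLStar G φ = _ from funext (formalLStar_apply φ)]
  refine Continuous.memLp_of_hasCompactSupport ?_ ?_
  · exact (((hc.clm_apply (by fun_prop)).neg.add (hc.clm_apply (by fun_prop))).sub
      (hc.clm_apply (by fun_prop))).add (continuous_finsetSum _ fun i _ => hc2 i)
  · refine (((hasCompactSupport_fderiv_apply φ.2.2 _).neg.add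
      (hasCompactSupport_fderiv_apply φ.2.2 _)).sub
      (hasCompactSupport_fderiv_apply φ.2.2 _)).add ?_
    refine HasCompactSupport.intro φ.2.2 fun p hp => Finset.sum_eq_zero fun i _ => ?_
    refine image_eq_zero_of_notMem_tsupport (f := fun p => fderiv ℝ (fun q => fderiv ℝ φ.1 q
      (0, EuclideanSpace.basisFun (Fin d) ℝ i)) p (0, EuclideanSpace.basisFun (Fin d) ℝ i))
      fun hp' => hp ?_
    exact tsupport_fderiv_apply_subset ℝ _ (tsupport_fderiv_apply_subset ℝ _ hp')

theorem sum_coord_fderiv_snd (f : Phase d → ℝ) (p : Phase d) (a : Pos d) :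
    fderiv ℝ f p (0, a) = ∑ i, a i * fderiv ℝ f p (0, EuclideanSpace.basisFun (Fin d) ℝ i) := by
  have h : ((fderiv ℝ f p).comp (ContinuousLinearMap.inr ℝ (Pos d) (Pos d))) a = _ :=
    congrArg _ ((EuclideanSpace.basisFun (Fin d) ℝ).sum_repr a).symm
  simpa only [map_sum, map_smul, ContinuousLinearMap.comp_apply, ContinuousLinearMap.inr_apply,
    EuclideanSpace.basisFun_repr, smul_eq_mul] using h

theorem sum_coord_fderiv_fst (f : Phase d → ℝ) (p : Phase d) (a : Pos d) :
    fderiv ℝ f p (a, 0) = ∑ i, a i * fderiv ℝ f p (EuclideanSpace.basisFun (Fin d) ℝ i, 0) := by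
  have h : ((fderiv ℝ f p).comp (ContinuousLinearMap.inl ℝ (Pos d) (Pos d))) a = _ :=
    congrArg _ ((EuclideanSpace.basisFun (Fin d) ℝ).sum_repr a).symm
  simpa only [map_sum, map_smul, ContinuousLinearMap.comp_apply, ContinuousLinearMap.inl_apply,
    EuclideanSpace.basisFun_repr, smul_eq_mul] using h

theorem inner_basisFun (a : Pos d) (i : Fin d) :
    ⟪a, EuclideanSpace.basisFun (Fin d) ℝ i⟫ = a i := by
  simp [EuclideanSpace.inner_single_right]

/-- The derivative `e^H ∂_w (ψ e^{-H})`. -/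
def weightedDeriv (G : Pos d → ℝ) (ψ : Phase d → ℝ) (w p : Phase d) : ℝ :=
  fderiv ℝ ψ p w - ψ p * (⟪p.2, w.2⟫ + ⟪∇ G p.1, w.1⟫)

theorem continuous_weightedDeriv (hG : ContDiff ℝ 1 G) {ψ : Phase d → ℝ} (hψ : ContDiff ℝ 1 ψ)
    (w : Phase d) : Continuous (weightedDeriv G ψ w) := by
  have hc : Continuous fun p => fderiv ℝ ψ p w :=
    (hψ.continuous_fderiv (by simp)).clm_apply continuous_const
  have hgrad := continuous_gradient hG
  have hψ0 := hψ.continuous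
  unfold weightedDeriv
  fun_prop

theorem hasCompactSupport_weightedDeriv {ψ : Phase d → ℝ} (hψc : HasCompactSupport ψ)
    (w : Phase d) : HasCompactSupport (weightedDeriv G ψ w) :=
  (hasCompactSupport_fderiv_apply hψc fun _ => w).sub hψc.mul_right

theorem integrable_weightedDeriv (hG : ContDiff ℝ 1 G) {ψ : Phase d → ℝ} (hψ : ContDiff ℝ 1 ψ)
    (hψc : HasCompactSupport ψ) (w : Phase d) : Integrable (weightedDeriv G ψ w) (mu G) :=
  (continuous_weightedDeriv hG hψ w).integrable_of_hasCompactSupport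
    (hasCompactSupport_weightedDeriv hψc w)

/-- Integration by parts against `μ` in the direction `w`, with a bounded coefficient which is
constant in the direction `w` but may be rough in the other directions. -/
theorem integral_coeff_mul_weightedDeriv (hG : ContDiff ℝ 1 G) {b ψ : Phase d → ℝ} {w : Phase d}
    {M : ℝ} (hbm : AEStronglyMeasurable b volume) (hb : ∀ᵐ p, ‖b p‖ ≤ M)
    (hbw : ∀ p (t : ℝ), b (p + t • w) = b p) (hψ : ContDiff ℝ 1 ψ) (hψc : HasCompactSupport ψ) :
    ∫ p, b p * weightedDeriv G ψ w p ∂(mu G) = 0 := by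
  have hHc := continuous_hamiltonian hG.continuous
  have hρ : Continuous fun p => Real.exp (-hamiltonian G p) := by fun_prop
  have hint : ∀ k : Phase d → ℝ, Continuous k → HasCompactSupport k →
      Integrable fun p => b p * k p := fun k hk hkc =>
    (hk.integrable_of_hasCompactSupport hkc).bdd_mul hbm hb
  have : (volume : Measure (Phase d)).IsAddHaarMeasure :=
    inferInstanceAs (Measure.IsAddHaarMeasure (volume.prod volume))
  rw [integral_gibbs hHc]
  refine mul_eq_zero_of_right _ ?_
  refine integral_hasLineDerivAt_eq_zero (w := w)
    (F := fun p => b p * (ψ p * Real.exp (-hamiltonian G p)))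
    (hint _ (hψ.continuous.mul hρ) hψc.mul_right) ?_ fun p => ?_
  · simpa only [mul_assoc, Pi.mul_apply] using hint _ ((continuous_weightedDeriv hG hψ w).mul hρ)
      (hasCompactSupport_weightedDeriv hψc w).mul_right
  · have h1 := HasDerivAt.mul
      (((hψ.differentiable (by simp)) p).hasFDerivAt.hasLineDerivAt w)
      ((hasFDerivAt_exp_neg_hamiltonian (hG.differentiable (by simp)) p).hasLineDerivAt w)
    -- Along the line through `p` in direction `w` the coefficient `b` is frozen at `b p`, so its
    -- roughness elsewhere does not matter.
    have h2 := HasDerivAt.const_mul (b p) h1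
    refine HasDerivAt.congr_deriv (h2.congr_of_eventuallyEq
      (Filter.Eventually.of_forall fun t => ?_)) ?_
    · simp only [hbw, Pi.mul_apply]
    · simp [inner_gradient_left, weightedDeriv]
      ring

theorem integral_weightedDeriv (hG : ContDiff ℝ 1 G) {ψ : Phase d → ℝ}
    (hψ : ContDiff ℝ 1 ψ) (hψc : HasCompactSupport ψ) (w : Phase d) :
    ∫ p, weightedDeriv G ψ w p ∂(mu G) = 0 := by
  simpa using integral_coeff_mul_weightedDeriv hG (b := fun _ => 1) (w := w) (M := 1)
    aestronglyMeasurable_const (by simp) (fun _ _ => rfl) hψ hψc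

/-- This is the divergence form of `𝓛*` with respect to `μ`. The zeroth-order terms `± v_i ∂_i G φ`
of the two transport parts cancel, and the friction term comes from the weight in the second
velocity derivative. -/
theorem formalLStar_eq_sum_weightedDeriv (hG : ContDiff ℝ 2 G) (φ : TestFun d) (p : Phase d) :
    formalLStar G φ p = ∑ i,
      (-weightedDeriv G (fun q => ⟪q.2, EuclideanSpace.basisFun (Fin d) ℝ i⟫ * φ.1 q)
          (EuclideanSpace.basisFun (Fin d) ℝ i, 0) p
        + weightedDeriv G (fun q => fderiv ℝ G q.1 (EuclideanSpace.basisFun (Fin d) ℝ i) * φ.1 q)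
          (0, EuclideanSpace.basisFun (Fin d) ℝ i) p
        + weightedDeriv G (fun q => fderiv ℝ φ.1 q (0, EuclideanSpace.basisFun (Fin d) ℝ i))
          (0, EuclideanSpace.basisFun (Fin d) ℝ i) p) := by
  have hd := differentiable_testFun φ
  rw [formalLStar_apply, sum_coord_fderiv_fst, sum_coord_fderiv_snd φ.1 p (∇ G p.1),
    sum_coord_fderiv_snd φ.1 p p.2, ← Finset.sum_neg_distrib, ← Finset.sum_add_distrib,
    ← Finset.sum_sub_distrib, ← Finset.sum_add_distrib]
  refine Finset.sum_congr rfl fun i _ => ?_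
  have hgrad : fderiv ℝ G p.1 (EuclideanSpace.basisFun (Fin d) ℝ i) = (∇ G p.1) i := by
    rw [← inner_gradient_left, inner_basisFun]
  set e := EuclideanSpace.basisFun (Fin d) ℝ i with he
  have e1 : fderiv ℝ (fun q : Phase d => ⟪q.2, e⟫ * φ.1 q) p (e, 0)
      = ⟪p.2, e⟫ * fderiv ℝ φ.1 p (e, 0) := by
    have hL : HasFDerivAt (fun p : Phase d => ⟪p.2, e⟫) _ p :=
      (hasFDerivAt_snd (𝕜 := ℝ) (p := p)).inner ℝ (hasFDerivAt_const e p)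
    rw [(hL.fun_mul (hd p).hasFDerivAt).fderiv]
    simp
  have e2 : fderiv ℝ (fun q : Phase d => fderiv ℝ G q.1 e * φ.1 q) p (0, e)
      = fderiv ℝ G p.1 e * fderiv ℝ φ.1 p (0, e) := by
    have hD : DifferentiableAt ℝ (fun x => fderiv ℝ G x e) p.1 :=
      (((hG.fderiv_right (m := 1) (by norm_num)).clm_apply contDiff_const).differentiable
        (by simp)) p.1
    have hL : HasFDerivAt (fun p : Phase d => fderiv ℝ G p.1 e) _ p :=
      hD.hasFDerivAt.comp p (hasFDerivAt_fst (𝕜 := ℝ) (p := p))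
    rw [(hL.fun_mul (hd p).hasFDerivAt).fderiv]
    simp
  rw [weightedDeriv, weightedDeriv, weightedDeriv, e1, e2]
  rw [hgrad]
  simp only [he, inner_basisFun, inner_zero_right]
  ring

theorem integral_formalLStar (hG : ContDiff ℝ 2 G) (φ : TestFun d) :
    ∫ p, formalLStar G φ p ∂(mu G) = 0 := by
  have hG1 : ContDiff ℝ 1 G := hG.of_le (by norm_num)
  have hφ1 : ContDiff ℝ 1 φ.1 := φ.2.1.of_le (by exact_mod_cast le_top)
  simp_rw [formalLStar_eq_sum_weightedDeriv hG φ]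
  have hψ (i : Fin d) : ContDiff ℝ 1
      fun q : Phase d => ⟪q.2, EuclideanSpace.basisFun (Fin d) ℝ i⟫ * φ.1 q :=
    (contDiff_snd.inner ℝ contDiff_const).mul hφ1
  have hψ' (i : Fin d) : ContDiff ℝ 1
      fun q : Phase d => fderiv ℝ G q.1 (EuclideanSpace.basisFun (Fin d) ℝ i) * φ.1 q :=
    (((hG.fderiv_right (m := 1) (by norm_num)).comp contDiff_fst).clm_apply contDiff_const).mul hφ1
  have hψ'' (i : Fin d) : ContDiff ℝ 1
      fun q : Phase d => fderiv ℝ φ.1 q (0, EuclideanSpace.basisFun (Fin d) ℝ i) :=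
    (contDiff_fderiv_apply φ _).of_le (by exact_mod_cast le_top)
  have i1 := fun i => (integrable_weightedDeriv hG1 (hψ i) φ.2.2.mul_left
    (EuclideanSpace.basisFun (Fin d) ℝ i, 0)).fun_neg
  have i2 := fun i => integrable_weightedDeriv hG1 (hψ' i) φ.2.2.mul_left
    (0, EuclideanSpace.basisFun (Fin d) ℝ i)
  have i3 := fun i => integrable_weightedDeriv hG1 (hψ'' i)
    (hasCompactSupport_fderiv_apply φ.2.2 _) (0, EuclideanSpace.basisFun (Fin d) ℝ i)
  rw [integral_finsetSum _ fun i _ => ((i1 i).fun_add (i2 i)).fun_add (i3 i)]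
  refine Finset.sum_eq_zero fun i _ => ?_
  rw [integral_add ((i1 i).fun_add (i2 i)) (i3 i), integral_add (i1 i) (i2 i), integral_neg,
    integral_weightedDeriv hG1 (hψ i) φ.2.2.mul_left,
    integral_weightedDeriv hG1 (hψ' i) φ.2.2.mul_left,
    integral_weightedDeriv hG1 (hψ'' i) (hasCompactSupport_fderiv_apply φ.2.2 _)]
  simp

/-! ### The control operator -/

theorem hasWeakGradient_weakGradient {f : Pos d → ℝ} (h : ∃ g, HasWeakGradient f g) :
    HasWeakGradient f (weakGradient f) := by
  rw [weakGradient, dif_pos h]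
  exact h.choose_spec

/-- Both gradients have the same integrals against all test functions. This lets the `L^∞` bound of
some weak gradient pass to the chosen `weakGradient`. -/
theorem HasWeakGradient.ae_eq {f : Pos d → ℝ} {g g' : Pos d → Pos d} (h : HasWeakGradient f g)
    (h' : HasWeakGradient f g') : g =ᵐ[volume] g' := by
  refine ae_eq_of_integral_contDiff_smul_eq h.2.1 h'.2.1 fun φ hφ hφc => ?_
  rw [← neg_inj, ← h.2.2 φ hφ hφc, ← h'.2.2 φ hφ hφc]

theorem MemW1Infty.memLp_weakGradient {f : Pos d → ℝ} (h : MemW1Infty f) :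
    MemLp (weakGradient f) ⊤ volume := by
  obtain ⟨-, g, hg, hgL⟩ := h
  exact hgL.ae_eq (hg.ae_eq (hasWeakGradient_weakGradient ⟨g, hg⟩))

theorem MemW1Infty.ae_norm_weakGradient_le {f : Pos d → ℝ} (h : MemW1Infty f) :
    ∃ M : ℝ, ∀ᵐ p : Phase d, ‖weakGradient f p.1‖ ≤ M := by
  refine ⟨(eLpNorm (weakGradient f) ⊤ volume).toReal, ?_⟩
  refine Measure.quasiMeasurePreserving_fst.ae
    (p := fun x => ‖weakGradient f x‖ ≤ (eLpNorm (weakGradient f) ⊤ volume).toReal) ?_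
  filter_upwards [ae_le_eLpNormEssSup (f := weakGradient f) (μ := volume)] with x hx
  rw [← toReal_enorm]
  exact ENNReal.toReal_mono h.memLp_weakGradient.2.ne (by simpa using hx)

/-- The coefficient `∂_i α` depends on `x` only and the derivative is in a `v` direction, so
`integral_coeff_mul_weightedDeriv` applies although `∇α` is merely bounded. -/
theorem formalN_eq_sum_weightedDeriv (φ : TestFun d) (p : Phase d) :
    formalN α φ p = ∑ i, weakGradient α p.1 i *
      weightedDeriv G φ.1 (0, EuclideanSpace.basisFun (Fin d) ℝ i) p := by
  have h : formalN α φ p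
      = ⟪weakGradient α p.1, gradV φ.1 p⟫ - φ.1 p * ⟪weakGradient α p.1, p.2⟫ := rfl
  rw [h, inner_gradV (differentiable_testFun φ), sum_coord_fderiv_snd]
  simp only [weightedDeriv, inner_zero_right, add_zero, mul_sub,
    Finset.sum_sub_distrib, PiLp.inner_apply, Finset.mul_sum]
  congr 1
  refine Finset.sum_congr rfl fun i _ => ?_
  simp
  ring

theorem MemW1Infty.aestronglyMeasurable_coord {f : Pos d → ℝ} (h : MemW1Infty f) (i : Fin d) :
    AEStronglyMeasurable (fun p : Phase d => weakGradient f p.1 i) volume :=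
  (EuclideanSpace.proj (𝕜 := ℝ) i).continuous.comp_aestronglyMeasurable
    (h.memLp_weakGradient.1.comp_quasiMeasurePreserving Measure.quasiMeasurePreserving_fst)

theorem memLp_weakGradient_mul_weightedDeriv (hG : ContDiff ℝ 1 G) (hα : MemW1Infty α)
    (φ : TestFun d) (i : Fin d) (w : Phase d) :
    MemLp (fun p => weakGradient α p.1 i * weightedDeriv G φ.1 w p) 2 (mu G) := by
  obtain ⟨M, hM⟩ := hα.ae_norm_weakGradient_le
  have hφ1 : ContDiff ℝ 1 φ.1 := φ.2.1.of_le (by exact_mod_cast le_top)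
  have hac := gibbs_absolutelyContinuous (hamiltonian G)
  have hk : MemLp (weightedDeriv G φ.1 w) 2 (mu G) :=
    (continuous_weightedDeriv hG hφ1 w).memLp_of_hasCompactSupport
      (hasCompactSupport_weightedDeriv φ.2.2 w)
  refine hk.of_le_mul (c := M)
    (((hα.aestronglyMeasurable_coord i).mono_ac hac).mul hk.1) ?_
  filter_upwards [hac.ae_le hM] with p hp
  rw [norm_mul]
  gcongr
  exact (PiLp.norm_apply_le _ i).trans hp

theorem memLp_formalN (hG : ContDiff ℝ 1 G) (hα : MemW1Infty α) (φ : TestFun d) :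
    MemLp (formalN α φ) 2 (mu G) := by
  rw [show formalN α φ = _ from funext (formalN_eq_sum_weightedDeriv (G := G) φ)]
  exact memLp_finsetSum _ fun i _ => memLp_weakGradient_mul_weightedDeriv hG hα φ i _

theorem integral_formalN (hG : ContDiff ℝ 1 G) (hα : MemW1Infty α) (φ : TestFun d) :
    ∫ p, formalN α φ p ∂(mu G) = 0 := by
  obtain ⟨M, hM⟩ := hα.ae_norm_weakGradient_le
  simp_rw [formalN_eq_sum_weightedDeriv (G := G) φ]
  rw [integral_finsetSum _ fun i _ =>
    (memLp_weakGradient_mul_weightedDeriv hG hα φ i _).integrable (by norm_num)]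
  refine Finset.sum_eq_zero fun i _ => ?_
  refine integral_coeff_mul_weightedDeriv hG (hα.aestronglyMeasurable_coord i) (M := M) ?_
    (fun p t => by simp) (φ.2.1.of_le (by exact_mod_cast le_top)) φ.2.2
  filter_upwards [hM] with p hp
  exact (PiLp.norm_apply_le _ i).trans hp

end MeanZero


/-! ### Cutoff functions -/

section Cutoff

variable {d : ℕ} {G : Pos d → ℝ}

theorem hasFDerivAt_product_scaled {f g : Pos d → ℝ} (hf : Differentiable ℝ f)
    (hg : Differentiable ℝ g) (ε δ : ℝ) (p : Phase d) :
    HasFDerivAt (fun q : Phase d => f (ε • q.1) * g (δ • q.2))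
      (f (ε • p.1) • δ • (fderiv ℝ g (δ • p.2)).comp (ContinuousLinearMap.snd ℝ (Pos d) (Pos d)) +
        g (δ • p.2) • ε • (fderiv ℝ f (ε • p.1)).comp
          (ContinuousLinearMap.fst ℝ (Pos d) (Pos d))) p := by
  have h1 : HasFDerivAt (fun q : Phase d => f (ε • q.1)) _ p :=
    (hf (ε • p.1)).hasFDerivAt.comp p ((hasFDerivAt_fst (𝕜 := ℝ) (p := p)).const_smul ε)
  have h2 : HasFDerivAt (fun q : Phase d => g (δ • q.2)) _ p :=
    (hg (δ • p.2)).hasFDerivAt.comp p ((hasFDerivAt_snd (𝕜 := ℝ) (p := p)).const_smul δ)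
  refine (h1.fun_mul h2).congr_fderiv ?_
  ext <;> simp

theorem fderiv_product_scaled_snd {f g : Pos d → ℝ} (hf : Differentiable ℝ f)
    (hg : Differentiable ℝ g) (ε δ : ℝ) (p : Phase d) (a : Pos d) :
    fderiv ℝ (fun q : Phase d => f (ε • q.1) * g (δ • q.2)) p (0, a)
      = δ * (f (ε • p.1) * fderiv ℝ g (δ • p.2) a) := by
  rw [(hasFDerivAt_product_scaled hf hg ε δ p).fderiv]
  simp
  ring

theorem fderiv_product_scaled_fst {f g : Pos d → ℝ} (hf : Differentiable ℝ f)
    (hg : Differentiable ℝ g) (ε δ : ℝ) (p : Phase d) (a : Pos d) :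
    fderiv ℝ (fun q : Phase d => f (ε • q.1) * g (δ • q.2)) p (a, 0)
      = ε * (g (δ • p.2) * fderiv ℝ f (ε • p.1) a) := by
  rw [(hasFDerivAt_product_scaled hf hg ε δ p).fderiv]
  simp
  ring

/-- A smooth bump function on `ℝ^d`, equal to `1` on the unit ball. -/
def bump (d : ℕ) : ContDiffBump (0 : Pos d) := ⟨1, 2, one_pos, one_lt_two⟩

/-- The anisotropic cutoff `(x, v) ↦ b(ε x) b(δ v)`. -/
def cutoff (d : ℕ) {ε δ : ℝ} (hε : 0 < ε) (hδ : 0 < δ) : TestFun d :=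
  ⟨fun p => bump d (ε • p.1) * bump d (δ • p.2), by
    refine ⟨?_, ?_⟩
    · exact ((bump d).contDiff.comp (contDiff_fst.const_smul ε)).mul
        ((bump d).contDiff.comp (contDiff_snd.const_smul δ))
    · have hx : HasCompactSupport fun x : Pos d => bump d (ε • x) :=
        (bump d).hasCompactSupport.comp_homeomorph (Homeomorph.smulOfNeZero ε hε.ne')
      have hv : HasCompactSupport fun v : Pos d => bump d (δ • v) :=
        (bump d).hasCompactSupport.comp_homeomorph (Homeomorph.smulOfNeZero δ hδ.ne')
      refine HasCompactSupport.intro (IsCompact.prod hx hv) fun p hp => ?_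
      rw [Set.mem_prod, not_and_or] at hp
      rcases hp with hp | hp
      · exact mul_eq_zero_of_left
          (image_eq_zero_of_notMem_tsupport (f := fun x : Pos d => bump d (ε • x)) hp) _
      · exact mul_eq_zero_of_right _
          (image_eq_zero_of_notMem_tsupport (f := fun v : Pos d => bump d (δ • v)) hp)⟩

theorem cutoff_apply {ε δ : ℝ} (hε : 0 < ε) (hδ : 0 < δ) (p : Phase d) :
    (cutoff d hε hδ).1 p = bump d (ε • p.1) * bump d (δ • p.2) := rfl

theorem norm_cutoff_le_one {ε δ : ℝ} (hε : 0 < ε) (hδ : 0 < δ) (p : Phase d) :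
    ‖(cutoff d hε hδ).1 p‖ ≤ 1 := by
  rw [cutoff_apply, Real.norm_of_nonneg (mul_nonneg (bump d).nonneg (bump d).nonneg)]
  exact mul_le_one₀ (bump d).le_one (bump d).nonneg (bump d).le_one

theorem cutoff_eq_one {ε δ : ℝ} (hε : 0 < ε) (hδ : 0 < δ) {p : Phase d}
    (h1 : ε * ‖p.1‖ ≤ 1) (h2 : δ * ‖p.2‖ ≤ 1) : (cutoff d hε hδ).1 p = 1 := by
  have h : ∀ {r : ℝ} {x : Pos d}, 0 < r → r * ‖x‖ ≤ 1 → bump d (r • x) = 1 := fun hr hx =>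
    (bump d).one_of_mem_closedBall (by
      rw [mem_closedBall_zero_iff, norm_smul, Real.norm_of_nonneg hr.le]
      exact hx)
  rw [cutoff_apply, h hε h1, h hδ h2, one_mul]

/-- `𝓛*` of the cutoff is of order `ε` if the velocity scale is small enough relative to the size
of `∇G` on the position support. -/
theorem exists_norm_formalLStar_cutoff_le (d : ℕ) :
    ∃ C : ℝ, ∀ (G : Pos d → ℝ) (ε δ : ℝ) (hε : 0 < ε) (hδ : 0 < δ), δ ≤ 1 → δ ≤ ε →
      (∀ x, ε * ‖x‖ ≤ 2 → δ * ‖∇ G x‖ ≤ ε) →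
      ∀ p, ‖formalLStar G (cutoff d hε hδ) p‖ ≤ ε * (C * (1 + ‖p.2‖)) := by
  have hb : ContDiff ℝ ∞ (bump d) := (bump d).contDiff
  have hbd : Differentiable ℝ (bump d) := hb.differentiable (by simp)
  have hb' : ∀ e, ContDiff ℝ ∞ fun z => fderiv ℝ (bump d) z e := fun e =>
    (hb.fderiv_right (m := ∞) (by simp)).clm_apply contDiff_const
  obtain ⟨C₁, hC₁⟩ := ((bump d).hasCompactSupport.fderiv ℝ).exists_bound_of_continuous
    (hb.continuous_fderiv (by simp))
  have hC₁0 : 0 ≤ C₁ := (norm_nonneg _).trans (hC₁ 0)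
  have hlap : ∀ i, ∃ C, ∀ z, ‖fderiv ℝ (fun z => fderiv ℝ (bump d) z
      (EuclideanSpace.basisFun (Fin d) ℝ i)) z (EuclideanSpace.basisFun (Fin d) ℝ i)‖ ≤ C :=
    fun i => HasCompactSupport.exists_bound_of_continuous
      (hasCompactSupport_fderiv_apply (hasCompactSupport_fderiv_apply (bump d).hasCompactSupport _)
        _) (((hb' _).continuous_fderiv (by simp)).clm_apply continuous_const)
  choose C₂ hC₂ using hlap
  have hC₂0 : ∀ i, 0 ≤ C₂ i := fun i => (norm_nonneg _).trans (hC₂ i 0)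
  -- Transport and friction contribute `C₁ ‖v‖` each, the force term `C₁`, and the Laplacian `∑ C₂
  -- i`, all times `ε`.
  refine ⟨2 * C₁ + ∑ i, C₂ i, fun G ε δ hε hδ hδ1 hδε hGδ p => ?_⟩
  have hS : 0 ≤ ∑ i, C₂ i := Finset.sum_nonneg fun i _ => hC₂0 i
  have hb1 : ∀ z, ‖bump d z‖ ≤ 1 := fun z => by
    rw [Real.norm_of_nonneg (bump d).nonneg]; exact (bump d).le_one
  have hfd : ∀ z a, ‖fderiv ℝ (bump d) z a‖ ≤ C₁ * ‖a‖ := fun z a =>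
    ((fderiv ℝ (bump d) z).le_opNorm a).trans (by gcongr; exact hC₁ z)
  have t1 : ‖fderiv ℝ (cutoff d hε hδ).1 p (p.2, 0)‖ ≤ ε * (C₁ * ‖p.2‖) := by
    rw [show (cutoff d hε hδ).1 = fun p => bump d (ε • p.1) * bump d (δ • p.2) from rfl,
      fderiv_product_scaled_fst hbd hbd, norm_mul, norm_mul, Real.norm_of_nonneg hε.le]
    exact mul_le_mul_of_nonneg_left
      ((mul_le_mul (hb1 _) (hfd _ _) (norm_nonneg _) zero_le_one).trans_eq (one_mul _)) hε.le
  have t2 : ‖fderiv ℝ (cutoff d hε hδ).1 p (0, ∇ G p.1)‖ ≤ ε * C₁ := by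
    rw [show (cutoff d hε hδ).1 = fun p => bump d (ε • p.1) * bump d (δ • p.2) from rfl,
      fderiv_product_scaled_snd hbd hbd, norm_mul, norm_mul, Real.norm_of_nonneg hδ.le]
    -- On the position support the scale hypothesis absorbs `∇G`; outside it the position bump,
    -- which has outer radius `2`, vanishes.
    by_cases hx : ε * ‖p.1‖ ≤ 2
    · calc δ * (‖bump d (ε • p.1)‖ * ‖fderiv ℝ (bump d) (δ • p.2) (∇ G p.1)‖)
          ≤ δ * (1 * (C₁ * ‖∇ G p.1‖)) := by
            gcongr
            · exact hb1 _
            · exact hfd _ _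
        _ = (δ * ‖∇ G p.1‖) * C₁ := by ring
        _ ≤ ε * C₁ := by gcongr; exact hGδ _ hx
    · have : bump d (ε • p.1) = 0 := (bump d).zero_of_le_dist (by
        rw [dist_zero_right, norm_smul, Real.norm_of_nonneg hε.le]
        exact (not_le.1 hx).le)
      rw [this, norm_zero, zero_mul, mul_zero]
      positivity
  have t3 : ‖fderiv ℝ (cutoff d hε hδ).1 p (0, p.2)‖ ≤ ε * (C₁ * ‖p.2‖) := by
    rw [show (cutoff d hε hδ).1 = fun p => bump d (ε • p.1) * bump d (δ • p.2) from rfl,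
      fderiv_product_scaled_snd hbd hbd, norm_mul, norm_mul, Real.norm_of_nonneg hδ.le]
    exact mul_le_mul hδε ((mul_le_mul (hb1 _) (hfd _ _) (norm_nonneg _) zero_le_one).trans_eq
      (one_mul _)) (by positivity) hε.le
  have t4 : ‖∑ i, fderiv ℝ (fun q => fderiv ℝ (cutoff d hε hδ).1 q
      (0, EuclideanSpace.basisFun (Fin d) ℝ i)) p (0, EuclideanSpace.basisFun (Fin d) ℝ i)‖
      ≤ ε * ∑ i, C₂ i := by
    rw [Finset.mul_sum]
    refine norm_sum_le_of_le _ fun i _ => ?_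
    have h1 : (fun q => fderiv ℝ (cutoff d hε hδ).1 q (0, EuclideanSpace.basisFun (Fin d) ℝ i))
        = fun q : Phase d => (δ * bump d (ε • q.1)) *
          fderiv ℝ (bump d) (δ • q.2) (EuclideanSpace.basisFun (Fin d) ℝ i) := by
      funext q
      rw [mul_assoc]
      exact fderiv_product_scaled_snd hbd hbd ε δ q _
    rw [h1, fderiv_product_scaled_snd (f := fun z => δ * bump d z) (hbd.const_mul δ)
      ((hb' _).differentiable (by simp)), norm_mul, norm_mul, norm_mul, Real.norm_of_nonneg hδ.le]
    -- Two velocity derivatives produce `δ²`; one factor is bounded by `1`, the other by `ε`.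
    calc _ ≤ δ * ((1 * 1) * C₂ i) := by
          gcongr
          · exact hb1 _
          · exact hC₂ i _
      _ ≤ ε * C₂ i := by
          rw [one_mul, one_mul]
          exact mul_le_mul_of_nonneg_right hδε (hC₂0 i)
  rw [formalLStar_apply]
  refine (norm_add_le_of_le (norm_sub_le_of_le (norm_add_le_of_le
    ((norm_neg _).trans_le t1) t2) t3) t4).trans ?_
  have : 0 ≤ ‖p.2‖ * ∑ i, C₂ i := mul_nonneg (norm_nonneg _) hS
  nlinarith [mul_nonneg hε.le this, mul_nonneg hε.le hC₁0]

/-- A continuous `∇G` is bounded by some `R` on the ball of radius `2 / ε`, so `δ = ε / (1 + R)`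
works. No growth condition on `G` enters, since `δ` is chosen after `ε`. -/
theorem exists_velocity_scale (hG : ContDiff ℝ 1 G) {ε : ℝ} (hε : 0 < ε) :
    ∃ δ : ℝ, 0 < δ ∧ δ ≤ ε ∧ ∀ x, ε * ‖x‖ ≤ 2 → δ * ‖∇ G x‖ ≤ ε := by
  obtain ⟨R, hR⟩ := (isCompact_closedBall (0 : Pos d) (2 / ε)).exists_bound_of_continuousOn
    (continuous_gradient hG).continuousOn
  have hR0 : 0 ≤ R := (norm_nonneg _).trans (hR 0 (by simp; positivity))
  refine ⟨ε / (1 + R), by positivity, div_le_self hε.le (by linarith), fun x hx => ?_⟩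
  have h := hR x (by rw [mem_closedBall_zero_iff, le_div_iff₀ hε, mul_comm]; exact hx)
  rw [div_mul_eq_mul_div, div_le_iff₀ (by positivity)]
  gcongr
  linarith

end Cutoff


/-! ### The constant function and the adjoint operators -/

section Adjoint

variable {d : ℕ} {G α : Pos d → ℝ}

theorem dense_opA_domain (hG : ContDiff ℝ 1 G) : Dense ((opA G).domain : Set (State G)) :=
  (dense_testOperator_domain (memLp_formalLStar hG)).mono (LinearPMap.le_closure _).1

theorem dense_opN₀_domain (hG : ContDiff ℝ 1 G) (hα : MemW1Infty α) :
    Dense ((opN₀ G α).domain : Set (State G)) :=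
  dense_testOperator_domain (memLp_formalN hG hα)

/-- Orthogonality of the second component to 𝟙 is a closed condition on `Y × Y`, so it passes from
the graph on test functions to its closure. -/
theorem inner_one_opA (hG : ContDiff ℝ 2 G) (hi : Integrable fun x => Real.exp (-G x))
    (x : (opA G).domain) : ⟪one G, opA G x⟫ = 0 := by
  have h0 := inner_one_testOperator hG.continuous hi (integral_formalLStar hG)
  have hgraph : ∀ q ∈ (testOperator G (formalLStar G)).graph, ⟪one G, q.2⟫ = 0 := by
    intro q hq
    obtain ⟨y, -, hy⟩ := (LinearPMap.mem_graph_iff _).1 hq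
    rw [← hy]
    exact h0 y
  -- The closure of a non-closable operator is by convention the operator itself, so both cases are
  -- covered and closability need not be shown.
  by_cases hc : (testOperator G (formalLStar G)).IsClosable
  · have hx : ((x : State G), opA G x) ∈ closure
        ((testOperator G (formalLStar G)).graph : Set (State G × State G)) := by
      have hx' : ((x : State G), opA G x) ∈ (testOperator G (formalLStar G)).closure.graph :=
        (opA G).mem_graph x
      rw [← hc.graph_closure_eq_closure_graph] at hx'
      exact hx'
    have hcl : IsClosed {q : State G × State G | ⟪one G, q.2⟫ = 0} :=
      isClosed_eq (continuous_const.inner continuous_snd) continuous_const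
    exact closure_minimal hgraph hcl hx
  · have hx := (opA G).mem_graph x
    have e : opA G = testOperator G (formalLStar G) := LinearPMap.closure_def' hc
    exact hgraph ((x : State G), opA G x) (e ▸ hx)

theorem one_mem_opAdag_domain (hG : ContDiff ℝ 2 G) (hi : Integrable fun x => Real.exp (-G x)) :
    one G ∈ (opAdag G).domain :=
  LinearPMap.mem_adjoint_domain_of_exists _
    ⟨0, fun x => by rw [inner_zero_left, inner_one_opA hG hi]⟩

theorem opAdag_one (hG : ContDiff ℝ 2 G) (hi : Integrable fun x => Real.exp (-G x)) :
    opAdag G ⟨one G, one_mem_opAdag_domain hG hi⟩ = 0 :=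
  LinearPMap.adjoint_apply_eq (dense_opA_domain (hG.of_le (by norm_num))) _
    fun x => by rw [inner_zero_left, inner_one_opA hG hi]

theorem inner_toLp_opAdag (hG : ContDiff ℝ 1 G) (hi : Integrable fun x => Real.exp (-G x))
    (φ : TestFun d) (z : (opAdag G).domain) :
    ∫ p, φ.1 p * opAdag G z p ∂(mu G) = ∫ p, formalLStar G φ p * (z : State G) p ∂(mu G) := by
  have hT := memLp_formalLStar hG
  have hle := LinearPMap.le_closure (testOperator G (formalLStar G))
  have h := LinearPMap.adjoint_isFormalAdjoint (dense_opA_domain hG) z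
    ⟨_, hle.1 (toLp_mem_testOperator_domain hT φ)⟩
  have hval : opA G ⟨_, hle.1 (toLp_mem_testOperator_domain hT φ)⟩
      = (hT φ).toLp (formalLStar G φ) := by
    rw [← testOperator_toLp hG.continuous hi hT φ]
    exact (hle.2 rfl).symm
  rw [hval, real_inner_comm, inner_toLp_left, real_inner_comm, inner_toLp_left] at h
  exact h

/-- The range of `A†` consists of functions with mean zero. -/
theorem integral_opAdag (hG : ContDiff ℝ 1 G) (hi : Integrable fun x => Real.exp (-G x))
    (z : (opAdag G).domain) : ∫ p, opAdag G z p ∂(mu G) = 0 := by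
  obtain ⟨C, hC⟩ := exists_norm_formalLStar_cutoff_le d
  let ε : ℕ → ℝ := fun n => 1 / ((n : ℝ) + 1)
  have hε : ∀ n, 0 < ε n := fun n => by positivity
  have hε1 : ∀ n, ε n ≤ 1 := fun n => by
    rw [div_le_one (by positivity)]; linarith [n.cast_nonneg (α := ℝ)]
  have hε0 : Filter.Tendsto ε Filter.atTop (nhds 0) := tendsto_one_div_add_atTop_nhds_zero_nat
  choose δ hδ hδε hδG using fun n => exists_velocity_scale hG (hε n)
  let χ : ℕ → TestFun d := fun n => cutoff d (hε n) (hδ n)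
  have hlim1 : Filter.Tendsto (fun n => ∫ p, (χ n).1 p * opAdag G z p ∂(mu G)) Filter.atTop
      (nhds (∫ p, opAdag G z p ∂(mu G))) := by
    have hw : Integrable (opAdag G z : State G) (mu G) := (Lp.memLp _).integrable (by norm_num)
    refine tendsto_integral_of_dominated_convergence (fun p => ‖opAdag G z p‖)
      (fun n => (χ n).2.1.continuous.aestronglyMeasurable.mul hw.1) hw.norm
      (fun n => Filter.Eventually.of_forall fun p => ?_)
      (Filter.Eventually.of_forall fun p => ?_)
    · rw [norm_mul]
      exact mul_le_of_le_one_left (norm_nonneg _) (norm_cutoff_le_one _ _ p)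
    · refine tendsto_const_nhds.congr' ?_
      have h1 : ∀ᶠ n in Filter.atTop, ε n * ‖p.1‖ < 1 :=
        (by simpa using hε0.mul_const ‖p.1‖ :
          Filter.Tendsto (fun n => ε n * ‖p.1‖) Filter.atTop (nhds 0)).eventually_lt_const one_pos
      have h2 : ∀ᶠ n in Filter.atTop, ε n * ‖p.2‖ < 1 :=
        (by simpa using hε0.mul_const ‖p.2‖ :
          Filter.Tendsto (fun n => ε n * ‖p.2‖) Filter.atTop (nhds 0)).eventually_lt_const one_pos
      filter_upwards [h1, h2] with n hn1 hn2
      rw [cutoff_eq_one (hε n) (hδ n) hn1.le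
        ((mul_le_mul_of_nonneg_right (hδε n) (norm_nonneg _)).trans hn2.le), one_mul]
  have hlim2 : Filter.Tendsto (fun n => ∫ p, (χ n).1 p * opAdag G z p ∂(mu G)) Filter.atTop
      (nhds 0) := by
    have hv : MemLp (fun p : Phase d => C * (1 + ‖p.2‖)) 2 (mu G) := by
      have h1 : MemLp (fun _ : Phase d => (1 : ℝ)) 2 (mu G) := memLp_const 1
      exact (h1.add (memLp_norm_snd hG.continuous hi)).const_mul C
    have hint : Integrable (fun p => C * (1 + ‖p.2‖) * ‖(z : State G) p‖) (mu G) :=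
      hv.integrable_mul (Lp.memLp (z : State G)).norm
    -- Moving `A†` onto the cutoff gives `∫ 𝓛*χ_n z dμ`, which is `O(ε_n)` because `(1 + ‖v‖) |z|`
    -- is integrable by Cauchy–Schwarz.
    have hb : ∀ n, ‖∫ p, (χ n).1 p * opAdag G z p ∂(mu G)‖
        ≤ ε n * ∫ p, C * (1 + ‖p.2‖) * ‖(z : State G) p‖ ∂(mu G) := fun n => by
      rw [inner_toLp_opAdag hG hi, ← integral_const_mul]
      refine norm_integral_le_of_norm_le (hint.const_mul _)
        (Filter.Eventually.of_forall fun p => ?_)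
      rw [norm_mul, ← mul_assoc]
      exact mul_le_mul_of_nonneg_right (hC G _ _ (hε n) (hδ n) ((hδε n).trans (hε1 n)) (hδε n)
        (hδG n) p) (norm_nonneg _)
    exact squeeze_zero_norm hb (by simpa using hε0.mul_const _)
  exact tendsto_nhds_unique hlim1 hlim2

theorem inner_one_opN₀ (hG : ContDiff ℝ 1 G) (hi : Integrable fun x => Real.exp (-G x))
    (hα : MemW1Infty α) (x : (opN₀ G α).domain) : ⟪one G, opN₀ G α x⟫ = 0 :=
  inner_one_testOperator hG.continuous hi (integral_formalN hG hα) x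

theorem one_mem_adjoint_opN₀_domain (hG : ContDiff ℝ 1 G)
    (hi : Integrable fun x => Real.exp (-G x)) (hα : MemW1Infty α) :
    one G ∈ (opN₀ G α).adjoint.domain :=
  LinearPMap.mem_adjoint_domain_of_exists _
    ⟨0, fun x => by rw [inner_zero_left, inner_one_opN₀ hG hi hα]⟩

/-- The operator `dualN` is the dual of `N`. -/
theorem pairN_eq_inner_dualN (hG : ContDiff ℝ 1 G) (hα : MemW1Infty α) (y z : State G) :
    pairN G α y z = ⟪y, dualN G α z⟫ := by
  by_cases hz : z ∈ (opN₀ G α).adjointDomain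
  · have hz' : z ∈ (opN₀ G α).adjoint.domain := hz
    rw [pairN, dif_pos hz, dualN, dif_pos hz',
      LinearPMap.adjoint_apply_of_dense (dense_opN₀_domain hG hα), real_inner_comm]
    exact (InnerProductSpace.toDual_symm_apply).symm
  -- Both definitions branch on the same domain, so their default values agree and the identity
  -- holds for every `z`.
  · have hz' : z ∉ (opN₀ G α).adjoint.domain := hz
    rw [pairN, dif_neg hz, dualN, dif_neg hz', inner_zero_right]

/-- Since 𝟙 is in the domain of the adjoint and is sent to `0`, `z` and `z - c𝟙` lie in that domain
together. Off the domain both values are the default `0`, so no inclusion of `D(A†)` in it is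
required. -/
theorem dualN_sub_smul_one (hG : ContDiff ℝ 1 G) (hi : Integrable fun x => Real.exp (-G x))
    (hα : MemW1Infty α) (z : State G) (c : ℝ) : dualN G α (z - c • one G) = dualN G α z := by
  have h1 := one_mem_adjoint_opN₀_domain hG hi hα
  have hN1 : (opN₀ G α).adjoint ⟨one G, h1⟩ = 0 :=
    LinearPMap.adjoint_apply_eq (dense_opN₀_domain hG hα) _
      fun x => by rw [inner_zero_left, inner_one_opN₀ hG hi hα]
  by_cases hz : z ∈ (opN₀ G α).adjoint.domain
  · have hz' : z - c • one G ∈ (opN₀ G α).adjoint.domain :=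
      Submodule.sub_mem _ hz (Submodule.smul_mem _ c h1)
    rw [dualN, dif_pos hz', dualN, dif_pos hz]
    have e : (⟨z - c • one G, hz'⟩ : (opN₀ G α).adjoint.domain) = ⟨z, hz⟩ - c • ⟨one G, h1⟩ := rfl
    rw [e, LinearPMap.map_sub, LinearPMap.map_smul, hN1, smul_zero, sub_zero]
  · have hz' : z - c • one G ∉ (opN₀ G α).adjoint.domain := fun h => hz (by
      have := Submodule.add_mem _ h (Submodule.smul_mem _ c h1)
      rwa [sub_add_cancel] at this)
    rw [dualN, dif_neg hz', dualN, dif_neg hz]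

theorem dualN_one (hG : ContDiff ℝ 1 G) (hi : Integrable fun x => Real.exp (-G x))
    (hα : MemW1Infty α) : dualN G α (one G) = 0 := by
  rw [dualN, dif_pos (one_mem_adjoint_opN₀_domain hG hi hα)]
  exact LinearPMap.adjoint_apply_eq (dense_opN₀_domain hG hα) _
    fun x => by rw [inner_zero_left, inner_one_opN₀ hG hi hα]

end Adjoint

/-! ### The projections -/

section Projections

variable {d : ℕ} {G : Pos d → ℝ}

theorem projP_eq (y : State G) : projP G y = y - ⟪one G, y⟫ • one G := by
  rw [projP, inner_one_left]

theorem projP_add_projQ (y : State G) : projP G y + projQ G y = y := by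
  rw [projP, projQ, sub_add_cancel]

theorem mem_stateZero_iff (y : State G) : y ∈ StateZero G ↔ ⟪one G, y⟫ = 0 := by
  rw [inner_one_left]; rfl

theorem continuous_projP : Continuous (projP G) := by
  have : projP G = fun y => y - ⟪one G, y⟫ • one G := funext projP_eq
  rw [this]
  fun_prop

theorem inner_one_one [IsProbabilityMeasure (mu G)] : ⟪one G, one G⟫ = 1 := by
  rw [inner_one_left, one, integral_congr_ae (Lp.coeFn_const (p := 2) (μ := mu G) (1 : ℝ))]
  simp

theorem projP_mem_stateZero [IsProbabilityMeasure (mu G)] (y : State G) :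
    projP G y ∈ StateZero G := by
  rw [mem_stateZero_iff, projP_eq, inner_sub_right, inner_smul_right, inner_one_one, mul_one,
    sub_self]

theorem integral_eq_of_projQ_eq [IsProbabilityMeasure (mu G)] {y y' : State G}
    (h : projQ G y = projQ G y') : ∫ p, y p ∂(mu G) = ∫ p, y' p ∂(mu G) := by
  have := congrArg (fun w => ⟪one G, w⟫) h
  simpa only [projQ, inner_smul_right, inner_one_one, mul_one] using this

theorem inner_eq_inner_projP {w : State G} (y : State G) (hw : w ∈ StateZero G) :
    ⟪y, w⟫ = ⟪projP G y, w⟫ := by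
  rw [projP_eq, inner_sub_left, inner_smul_left, (mem_stateZero_iff w).1 hw, mul_zero, sub_zero]

end Projections

/-! ### Weak solutions -/

section Solutions

variable {d : ℕ} {G α : Pos d → ℝ} {T : ENNReal} {u : ℝ → ℝ} {y₀ : State G} {y : ℝ → State G}

theorem mem_timeInterval_of_mem_uIcc {t σ : ℝ} (ht : t ∈ timeInterval T)
    (hσ : σ ∈ Set.uIcc 0 t) : σ ∈ timeInterval T := by
  rw [Set.uIcc_of_le ht.1] at hσ
  exact ⟨hσ.1, (ENNReal.ofReal_le_ofReal hσ.2).trans ht.2⟩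

/-- Weak solutions conserve mass. -/
theorem IsWeakSolution.integral_eq (hG : ContDiff ℝ 2 G)
    (hi : Integrable fun x => Real.exp (-G x)) (hα : MemW1Infty α)
    (h : IsWeakSolution G α T u y₀ y) {t : ℝ} (ht : t ∈ timeInterval T) :
    ∫ p, y t p ∂(mu G) = ∫ p, y₀ p ∂(mu G) := by
  have hG1 : ContDiff ℝ 1 G := hG.of_le (by norm_num)
  -- With `z = 𝟙` the integrand vanishes identically, since `A†𝟙 = 0` and `N'𝟙 = 0`.
  have h1 := h.2 ⟨one G, one_mem_opAdag_domain hG hi⟩ t ht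
  simp only [opAdag_one hG hi, pairN_eq_inner_dualN hG1 hα, dualN_one hG1 hi hα, inner_zero_right,
    mul_zero, add_zero, intervalIntegral.integral_zero] at h1
  rw [real_inner_comm, inner_sub_right, inner_one_left, inner_one_left] at h1
  linarith

/-- For `z ∈ D(A†)` with mean zero, the weak formulation and the reduced one coincide along
functions with constant mean. -/
theorem weak_iff_reduced_of_projQ_eq (hG : ContDiff ℝ 1 G)
    (hi : Integrable fun x => Real.exp (-G x)) (hα : MemW1Infty α)
    (hQ : ∀ t ∈ timeInterval T, projQ G (y t) = projQ G y₀) (z : (opAdag G).domain)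
    (hz : (z : State G) ∈ StateZero G) {t : ℝ} (ht : t ∈ timeInterval T) :
    (⟪y t - y₀, (z : State G)⟫ =
        ∫ σ in (0 : ℝ)..t, (⟪y σ, opAdag G z⟫ + u σ * pairN G α (y σ) z)) ↔
      ⟪projP G (y t) - projP G y₀, (z : State G)⟫ =
        ∫ σ in (0 : ℝ)..t, (⟪projP G (y σ), opAdag G z⟫ +
          u σ * ⟪projP G (y σ) + projQ G y₀, dualN G α z⟫) := by
  have hleft : ⟪y t - y₀, (z : State G)⟫ = ⟪projP G (y t) - projP G y₀, (z : State G)⟫ := by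
    rw [inner_sub_left, inner_sub_left, inner_eq_inner_projP _ hz, inner_eq_inner_projP y₀ hz]
  have hright : ∫ σ in (0 : ℝ)..t, (⟪y σ, opAdag G z⟫ + u σ * pairN G α (y σ) z) =
      ∫ σ in (0 : ℝ)..t, (⟪projP G (y σ), opAdag G z⟫ +
        u σ * ⟪projP G (y σ) + projQ G y₀, dualN G α z⟫) := by
    refine intervalIntegral.integral_congr fun σ hσ => ?_
    -- `Qy` drops out of the drift because `A†z` has mean zero; in the control term `Py + Qy₀` is
    -- `y` itself.
    rw [inner_eq_inner_projP (y σ) (integral_opAdag hG hi z), pairN_eq_inner_dualN hG hα,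
      ← hQ σ (mem_timeInterval_of_mem_uIcc ht hσ), projP_add_projQ]
  rw [hleft, hright]

/-- An arbitrary `z` is replaced by `z₀ = z - ⟨𝟙, z⟩𝟙`, which is still in `D(A†)` and has mean zero.
The change is invisible on the right because `A†` and `N'` kill 𝟙, and on the left because `y(t) -
y₀` has mean zero. -/
theorem isWeakSolution_of_isReducedSolution (hG : ContDiff ℝ 2 G)
    (hi : Integrable fun x => Real.exp (-G x)) (hα : MemW1Infty α)
    (hr : IsReducedSolution G α T u y₀ fun t => projP G (y t))
    (hQ : ∀ t ∈ timeInterval T, projQ G (y t) = projQ G y₀) :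
    IsWeakSolution G α T u y₀ y := by
  have hG1 : ContDiff ℝ 1 G := hG.of_le (by norm_num)
  have : IsProbabilityMeasure (mu G) := isProbabilityMeasure_gibbs
    (continuous_hamiltonian hG.continuous) (integrable_exp_neg_hamiltonian hi)
  refine ⟨?_, fun z t ht => ?_⟩
  · refine (hr.1.add (continuousOn_const (c := projQ G y₀))).congr fun t ht => ?_
    rw [← hQ t ht, Pi.add_apply, projP_add_projQ]
  · have h1 := one_mem_opAdag_domain hG hi
    set c := ⟪one G, (z : State G)⟫ with hc
    let z₀ : (opAdag G).domain := z - c • ⟨one G, h1⟩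
    have hz₀ : (z₀ : State G) = (z : State G) - c • one G := rfl
    have hz₀mem : (z₀ : State G) ∈ StateZero G := by
      rw [hz₀, hc, ← projP_eq]
      exact projP_mem_stateZero _
    have hA : opAdag G z₀ = opAdag G z := by
      rw [LinearPMap.map_sub, LinearPMap.map_smul, opAdag_one hG hi, smul_zero, sub_zero]
    have key := (weak_iff_reduced_of_projQ_eq hG1 hi hα hQ z₀ hz₀mem ht).2 (hr.2.2 z₀ hz₀mem t ht)
    have hone : ⟪y t - y₀, one G⟫ = 0 := by
      rw [real_inner_comm, inner_sub_right, inner_one_left, inner_one_left,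
        integral_eq_of_projQ_eq (hQ t ht), sub_self]
    simp only [pairN_eq_inner_dualN hG1 hα] at key ⊢
    rw [hA, hz₀, dualN_sub_smul_one hG1 hi hα, inner_sub_right, inner_smul_right, hone, mul_zero,
      sub_zero] at key
    exact key

theorem IsWeakSolution.isReducedSolution (hG : ContDiff ℝ 2 G)
    (hi : Integrable fun x => Real.exp (-G x)) (hα : MemW1Infty α)
    (h : IsWeakSolution G α T u y₀ y) :
    IsReducedSolution G α T u y₀ fun t => projP G (y t) := by
  have : IsProbabilityMeasure (mu G) := isProbabilityMeasure_gibbs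
    (continuous_hamiltonian hG.continuous) (integrable_exp_neg_hamiltonian hi)
  refine ⟨continuous_projP.comp_continuousOn h.1, fun t _ => projP_mem_stateZero _,
    fun z hz t ht => ?_⟩
  refine (weak_iff_reduced_of_projQ_eq (hG.of_le (by norm_num)) hi hα (fun s hs => ?_) z hz ht).1
    (h.2 z t ht)
  rw [projQ, h.integral_eq hG hi hα hs, projQ]

end Solutions

end

end KineticFP

theorem proposition4p3 {d : ℕ} (G α : KineticFP.Pos d → ℝ)
    (hA1 : KineticFP.AssumptionA1 G) (hA2 : KineticFP.AssumptionA2 α)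
    (hA3 : KineticFP.AssumptionA3 G)
    (T : ENNReal) (u : ℝ → ℝ) (hu : KineticFP.IsControl T u)
    (y₀ : KineticFP.State G) (y : ℝ → KineticFP.State G) :
    (KineticFP.IsWeakSolution G α T u y₀ y ↔
      (∀ t ∈ KineticFP.timeInterval T,
        y t = KineticFP.projP G (y t) + KineticFP.projQ G (y t)) ∧
      KineticFP.IsReducedSolution G α T u y₀ (fun t => KineticFP.projP G (y t)) ∧
      ∀ t ∈ KineticFP.timeInterval T, KineticFP.projQ G (y t) = KineticFP.projQ G y₀) ∧
    (KineticFP.IsWeakSolution G α T u y₀ y →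
      ∀ t ∈ KineticFP.timeInterval T,
        ∫ p, y t p ∂(KineticFP.mu G) = ∫ p, y₀ p ∂(KineticFP.mu G)) := by
  have hG := hA3.contDiff
  have hi := hA1.integrable
  refine ⟨⟨fun h => ⟨fun t _ => (KineticFP.projP_add_projQ _).symm,
    h.isReducedSolution hG hi hA2, fun t ht => ?_⟩,
    fun h => KineticFP.isWeakSolution_of_isReducedSolution hG hi hA2 h.2.1 h.2.2⟩,
    fun h t ht => h.integral_eq hG hi hA2 ht⟩
  rw [KineticFP.projQ, h.integral_eq hG hi hA2 ht, KineticFP.projQ]
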